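/- Let $\mathcal H_1,\mathcal H_2$ be separable complex Hilbert spaces and let $\rho$ be a state (density operator: positive, trace class, trace one) on $\mathcal H_1\otimes\mathcal H_2$. For $k=1,2,3$ let $\mathrm{tr}^{(k)}$ denote the partial trace over the $k$-th place of a threefold tensor product, and put $\|T\|_1=\mathrm{tr}|T|$, $|T|=\sqrt{T^*T}$. A source-operator $T_{122}$ for $\rho$ is a self-adjoint (not necessarily positive) trace class operator on $\mathcal H_1\otimes\mathcal H_2\otimes\mathcal H_2$ with $\mathrm{tr}^{(2)}[T_{122}]=\mathrm{tr}^{(3)}[T_{122}]=\rho$; a source-operator $T_{112}$ for $\rho$ is a self-adjoint trace class operator on $\mathcal H_1\otimes\mathcal H_1\otimes\mathcal H_2$ with $\mathrm{tr}^{(1)}[T_{112}]=\mathrm{tr}^{(2)}[T_{112}]=\rho$. An observable is a bounded self-adjoint operator; $A,A_1,A_2$ below are any observables on $\mathcal H_1$ and $B,B_1,B_2$ any observables on $\mathcal H_2$, all of operator norm $\le 1$. (i) For every source-operator $T_{122}$ for $\rho$, the operator $\sigma_{T_{122}}:=\frac{1}{\|T_{122}\|_1}\mathrm{tr}^{(1)}\big[|T_{122}|\big]$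 is a density operator on $\mathcal H_2\otimes\mathcal H_2$, and $$\big|\mathrm{tr}[\rho(A\otimes B_1)]-\mathrm{tr}[\rho(A\otimes B_2)]\big|\le\|T_{122}\|_1\,\{1-\mathrm{tr}[\sigma_{T_{122}}(B_1\otimes B_2)]\}.$$ (ii) For every source-operator $T_{112}$ for $\rho$, the operator $\sigma_{T_{112}}:=\frac{1}{\|T_{112}\|_1}\mathrm{tr}^{(3)}\big[|T_{112}|\big]$ is a density operator on $\mathcal H_1\otimes\mathcal H_1$, and $$\big|\mathrm{tr}[\rho(A_1\otimes B)]-\mathrm{tr}[\rho(A_2\otimes B)]\big|\le\|T_{112}\|_1\,\{1-\mathrm{tr}[\sigma_{T_{112}}(A_1\otimes A_2)]\}.$$ In both right-hand sides the traces are real numbers, and the two inequalities also hold with the observables there interchanged, i.e. with $B_2\otimes B_1$ in place of $B_1\otimes B_2$ and $A_2\otimes A_1$ in place of $A_1\otimes A_2$. -/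

import Mathlib

open scoped TensorProduct InnerProductSpace

universe u v w u' v'

noncomputable section

/-- The Hilbert space tensor product `E ⊗ F`: the completion of the algebraic tensor product for
the inner product with `⟪x ⊗ y, x' ⊗ y'⟫ = ⟪x, x'⟫ ⟪y, y'⟫`. -/
def HilbertTensor (E : Type u) (F : Type v) [NormedAddCommGroup E] [InnerProductSpace ℂ E]
    [NormedAddCommGroup F] [InnerProductSpace ℂ F] : Type (max u v) :=
  UniformSpace.Completion (E ⊗[ℂ] F)

namespace HilbertTensor

variable {E : Type u} {F : Type v} {E' : Type u'} {F' : Type v'}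
  [NormedAddCommGroup E] [InnerProductSpace ℂ E]
  [NormedAddCommGroup F] [InnerProductSpace ℂ F]
  [NormedAddCommGroup E'] [InnerProductSpace ℂ E']
  [NormedAddCommGroup F'] [InnerProductSpace ℂ F']

instance : NormedAddCommGroup (HilbertTensor E F) :=
  inferInstanceAs (NormedAddCommGroup (UniformSpace.Completion (E ⊗[ℂ] F)))

instance : InnerProductSpace ℂ (HilbertTensor E F) :=
  inferInstanceAs (InnerProductSpace ℂ (UniformSpace.Completion (E ⊗[ℂ] F)))

instance : CompleteSpace (HilbertTensor E F) :=
  inferInstanceAs (CompleteSpace (UniformSpace.Completion (E ⊗[ℂ] F)))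

/-- The canonical isometric embedding of the algebraic tensor product, as a bounded operator. -/
def ofAlg (E : Type u) (F : Type v) [NormedAddCommGroup E] [InnerProductSpace ℂ E]
    [NormedAddCommGroup F] [InnerProductSpace ℂ F] : (E ⊗[ℂ] F) →L[ℂ] HilbertTensor E F :=
  UniformSpace.Completion.toComplL (𝕜 := ℂ) (E := E ⊗[ℂ] F)

theorem inner_ofAlg (s t : E ⊗[ℂ] F) : ⟪ofAlg E F s, ofAlg E F t⟫_ℂ = ⟪s, t⟫_ℂ :=
  UniformSpace.Completion.inner_coe s t

theorem denseRange_ofAlg : DenseRange (ofAlg E F) :=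
  UniformSpace.Completion.denseRange_coe

/-- The elementary tensor `x ⊗ y` in the Hilbert space tensor product. -/
def tmul (x : E) (y : F) : HilbertTensor E F :=
  ofAlg E F (x ⊗ₜ[ℂ] y)

theorem inner_tmul (x x' : E) (y y' : F) :
    ⟪tmul x y, tmul x' y'⟫_ℂ = ⟪x, x'⟫_ℂ * ⟪y, y'⟫_ℂ := by
  simp [tmul, inner_ofAlg]

/-- The bounded operator `A ⊗ B : E ⊗ F → E' ⊗ F'`, the continuous extension of
`x ⊗ y ↦ A x ⊗ B y`. -/
def map (A : E →L[ℂ] E') (B : F →L[ℂ] F') : HilbertTensor E F →L[ℂ] HilbertTensor E' F' :=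
  ContinuousLinearMap.completion (TensorProduct.mapL A B)

theorem map_tmul (A : E →L[ℂ] E') (B : F →L[ℂ] F') (x : E) (y : F) :
    map A B (tmul x y) = tmul (A x) (B y) := by
  exact ContinuousLinearMap.completion_apply_coe (TensorProduct.mapL A B) (x ⊗ₜ[ℂ] y)

/-- For fixed `x`, the bounded operator `y ↦ x ⊗ y`. -/
def mkLeft (F : Type v) [NormedAddCommGroup F] [InnerProductSpace ℂ F] (x : E) :
    F →L[ℂ] HilbertTensor E F :=
  (ofAlg E F) ∘L (TensorProduct.mkL ℂ E F x)

/-- For fixed `y`, the bounded operator `x ↦ x ⊗ y`. -/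
def mkRight (E : Type u) [NormedAddCommGroup E] [InnerProductSpace ℂ E] (y : F) :
    E →L[ℂ] HilbertTensor E F :=
  (ofAlg E F) ∘L
    ((TensorProduct.mkL ℂ E F).flip y)

theorem mkLeft_apply (x : E) (y : F) : mkLeft F x y = tmul x y := rfl

theorem mkRight_apply (x : E) (y : F) : mkRight E y x = tmul x y := rfl

end HilbertTensor

section TraceClass

variable (H : Type u) [NormedAddCommGroup H] [InnerProductSpace ℂ H] [CompleteSpace H]

/-- The index set of a chosen orthonormal (Hilbert) basis of `H`. -/
def BasisIndex : Set H := Classical.choose (exists_hilbertBasis ℂ H)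

/-- A chosen orthonormal (Hilbert) basis of `H`. The notions below do not depend on the choice. -/
def onb : HilbertBasis (BasisIndex H) ℂ H :=
  Classical.choose (Classical.choose_spec (exists_hilbertBasis ℂ H))

variable {H}

/-- `T` is a trace class operator: `tr |T| = ∑ₙ ⟪eₙ, |T| eₙ⟫ < ∞`, where `|T| = √(T* T)`. -/
def IsTraceClass (T : H →L[ℂ] H) : Prop :=
  Summable fun n : BasisIndex H => (⟪onb H n, CFC.abs T (onb H n)⟫_ℂ).re

/-- The trace norm `‖T‖₁ = tr |T|` (of a trace class operator). -/
def traceNorm (T : H →L[ℂ] H) : ℝ :=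
  ∑' n : BasisIndex H, (⟪onb H n, CFC.abs T (onb H n)⟫_ℂ).re

/-- The trace `tr[T] = ∑ₙ ⟪eₙ, T eₙ⟫` (of a trace class operator). -/
def opTrace (T : H →L[ℂ] H) : ℂ :=
  ∑' n : BasisIndex H, ⟪onb H n, T (onb H n)⟫_ℂ

/-- A (normal) state, i.e. a density operator: a positive trace class operator of trace one. -/
structure IsDensityOperator (ρ : H →L[ℂ] H) : Prop where
  nonneg : ρ.IsPositive
  traceClass : IsTraceClass ρ
  trace_eq_one : opTrace ρ = 1

end TraceClass

section PartialTrace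

open HilbertTensor ContinuousLinearMap

variable {E : Type u} {F : Type v} {G : Type w}
  [NormedAddCommGroup E] [InnerProductSpace ℂ E] [CompleteSpace E]
  [NormedAddCommGroup F] [InnerProductSpace ℂ F] [CompleteSpace F]
  [NormedAddCommGroup G] [InnerProductSpace ℂ G] [CompleteSpace G]

/-- Partial trace over the first place of `E ⊗ F ⊗ G`: the operator `R` on `F ⊗ G` with
`⟪ψ, R φ⟫ = ∑ₙ ⟪eₙ ⊗ ψ, T (eₙ ⊗ φ)⟫`. For trace class `T` the series converges absolutely in
operator norm. -/
def partialTrace₁ (T : HilbertTensor E (HilbertTensor F G) →L[ℂ]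
    HilbertTensor E (HilbertTensor F G)) : HilbertTensor F G →L[ℂ] HilbertTensor F G :=
  ∑' n : BasisIndex E,
    adjoint (mkLeft (HilbertTensor F G) (onb E n)) ∘L T ∘L
      mkLeft (HilbertTensor F G) (onb E n)

/-- Partial trace over the second place of `E ⊗ F ⊗ G`: the same with the isometries
`x ⊗ z ↦ x ⊗ eₙ ⊗ z`. -/
def partialTrace₂ (T : HilbertTensor E (HilbertTensor F G) →L[ℂ]
    HilbertTensor E (HilbertTensor F G)) : HilbertTensor E G →L[ℂ] HilbertTensor E G :=
  ∑' n : BasisIndex F,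
    adjoint (HilbertTensor.map (.id ℂ E) (mkLeft G (onb F n))) ∘L T ∘L
      HilbertTensor.map (.id ℂ E) (mkLeft G (onb F n))

/-- Partial trace over the third place of `E ⊗ F ⊗ G`: the same with the isometries
`x ⊗ y ↦ x ⊗ y ⊗ eₙ`. -/
def partialTrace₃ (T : HilbertTensor E (HilbertTensor F G) →L[ℂ]
    HilbertTensor E (HilbertTensor F G)) : HilbertTensor E F →L[ℂ] HilbertTensor E F :=
  ∑' n : BasisIndex G,
    adjoint (HilbertTensor.map (.id ℂ E) (mkRight F (onb G n))) ∘L T ∘L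
      HilbertTensor.map (.id ℂ E) (mkRight F (onb G n))

end PartialTrace

section SourceOperators

variable {H₁ : Type u} {H₂ : Type v}
  [NormedAddCommGroup H₁] [InnerProductSpace ℂ H₁] [CompleteSpace H₁]
  [NormedAddCommGroup H₂] [InnerProductSpace ℂ H₂] [CompleteSpace H₂]

/-- `T` on `H₁ ⊗ H₂ ⊗ H₂` is a source-operator for `ρ`: a self-adjoint trace class operator whose
partial traces over the second and over the third place both equal `ρ`. -/
structure IsSourceOperator₁₂₂ (ρ : HilbertTensor H₁ H₂ →L[ℂ] HilbertTensor H₁ H₂)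
    (T : HilbertTensor H₁ (HilbertTensor H₂ H₂) →L[ℂ] HilbertTensor H₁ (HilbertTensor H₂ H₂)) :
    Prop where
  selfAdjoint : IsSelfAdjoint T
  traceClass : IsTraceClass T
  partialTrace₂_eq : partialTrace₂ T = ρ
  partialTrace₃_eq : partialTrace₃ T = ρ

/-- `T` on `H₁ ⊗ H₁ ⊗ H₂` is a source-operator for `ρ`: a self-adjoint trace class operator whose
partial traces over the first and over the second place both equal `ρ`. -/
structure IsSourceOperator₁₁₂ (ρ : HilbertTensor H₁ H₂ →L[ℂ] HilbertTensor H₁ H₂)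
    (T : HilbertTensor H₁ (HilbertTensor H₁ H₂) →L[ℂ] HilbertTensor H₁ (HilbertTensor H₁ H₂)) :
    Prop where
  selfAdjoint : IsSelfAdjoint T
  traceClass : IsTraceClass T
  partialTrace₁_eq : partialTrace₁ T = ρ
  partialTrace₂_eq : partialTrace₂ T = ρ

/-- `σ_T = ‖T‖₁⁻¹ tr⁽¹⁾|T|` on `H₂ ⊗ H₂`, for `T` on `H₁ ⊗ H₂ ⊗ H₂`. -/
def sigma₁₂₂
    (T : HilbertTensor H₁ (HilbertTensor H₂ H₂) →L[ℂ] HilbertTensor H₁ (HilbertTensor H₂ H₂)) :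
    HilbertTensor H₂ H₂ →L[ℂ] HilbertTensor H₂ H₂ :=
  ((traceNorm T : ℂ)⁻¹) • partialTrace₁ (CFC.abs T)

/-- `σ_T = ‖T‖₁⁻¹ tr⁽³⁾|T|` on `H₁ ⊗ H₁`, for `T` on `H₁ ⊗ H₁ ⊗ H₂`. -/
def sigma₁₁₂
    (T : HilbertTensor H₁ (HilbertTensor H₁ H₂) →L[ℂ] HilbertTensor H₁ (HilbertTensor H₁ H₂)) :
    HilbertTensor H₁ H₁ →L[ℂ] HilbertTensor H₁ H₁ :=
  ((traceNorm T : ℂ)⁻¹) • partialTrace₃ (CFC.abs T)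

end SourceOperators

/-- A bounded quantum observable with operator norm at most one. -/
structure IsContractiveObservable {H : Type u} [NormedAddCommGroup H] [InnerProductSpace ℂ H]
    [CompleteSpace H] (W : H →L[ℂ] H) : Prop where
  selfAdjoint : IsSelfAdjoint W
  norm_le_one : ‖W‖ ≤ 1

end

/-! The core is Bell's inequality for commuting observables. If `a`, `b`, `c` commute pairwise and
lie between `-1` and `1`, then `±(ab - ac) ≤ 1 - bc`, because `2((1 - bc) + (ab - ac)) = (1 + a)(1 +
b)(1 - c) + (1 - a)(1 - b)(1 + c)` is a sum of products of commuting positive elements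
(`one_sub_mul_add_mul_sub_nonneg`). For `T₁₂₂` take `a = A ⊗ 1 ⊗ 1`, `b = 1 ⊗ 1 ⊗ B₁`, `c = 1 ⊗ B₂ ⊗
1`. Both partial traces of `T` are `ρ`, so `tr[ρ(A ⊗ B₁)] = tr[T ab]` and `tr[ρ(A ⊗ B₂)] = tr[T
ac]`, while `‖T‖₁ tr[σ(B₂ ⊗ B₁)] = tr[|T| bc]`. Hence `|tr[T(ab - ac)]| ≤ tr[|T|(1 - bc)]` is the
claim. All traces are computed from one expansion: `T = ∑ sᵢ |aᵢ⟩⟨aᵢ|` and `|T| = ∑ |aᵢ⟩⟨aᵢ|` with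
signs `sᵢ = ±1`, obtained from `T = T⁺ - T⁻` and `|T| = T⁺ + T⁻`
(`exists_isRankOneSum_of_isTraceClass`). Each trace becomes a series over `i`
(`IsRankOneSum.opTrace_tsum_conj_mul`), and the operator inequality is applied to each `aᵢ`
separately. -/

/-! ### Square summable families and Parseval's identity. -/

section SummableFamilies

variable {ι κ K : Type*} [NormedAddCommGroup K]

theorem summable_norm_mul_norm_of_sq {a b : ι → K} (ha : Summable fun i => ‖a i‖ ^ 2)
    (hb : Summable fun i => ‖b i‖ ^ 2) : Summable fun i => ‖a i‖ * ‖b i‖ := by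
  refine Summable.of_nonneg_of_le (fun i => by positivity) (fun i => ?_) (ha.add hb)
  nlinarith [sq_nonneg (‖a i‖ - ‖b i‖), sq_nonneg ‖a i‖, sq_nonneg ‖b i‖]

theorem summable_norm_sq_prod {p : κ → ι → K} {s : ι → ℝ}
    (hp : ∀ i, HasSum (fun n => ‖p n i‖ ^ 2) (s i)) (hs : Summable s) :
    Summable fun z : κ × ι => ‖p z.1 z.2‖ ^ 2 := by
  have h : Summable fun z : ι × κ => ‖p z.2 z.1‖ ^ 2 := by
    refine (summable_prod_of_nonneg fun z => by positivity).2 ⟨fun i => (hp i).summable, ?_⟩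
    simpa only [(hp _).tsum_eq] using hs
  exact (Equiv.prodComm κ ι).summable_iff.2 h

theorem HilbertBasis.hasSum_norm_inner_sq {H : Type*} [NormedAddCommGroup H]
    [InnerProductSpace ℂ H] (b : HilbertBasis κ ℂ H) (x : H) :
    HasSum (fun n => ‖⟪b n, x⟫_ℂ‖ ^ 2) (‖x‖ ^ 2) := by
  have h := Complex.hasSum_re (b.hasSum_inner_mul_inner x x)
  rw [show (⟪x, x⟫_ℂ).re = ‖x‖ ^ 2 from inner_self_eq_norm_sq (𝕜 := ℂ) x] at h
  refine h.congr_fun ?_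
  intro n
  rw [← inner_conj_symm x (b n), ← Complex.normSq_eq_conj_mul_self, Complex.ofReal_re,
    Complex.normSq_eq_norm_sq]

end SummableFamilies

/-! ### Rank one expansions, traces and partial traces. -/

namespace ContinuousLinearMap

section RankOneSum

variable {ι κ H K L : Type*}
  [NormedAddCommGroup H] [InnerProductSpace ℂ H] [CompleteSpace H]
  [NormedAddCommGroup K] [InnerProductSpace ℂ K] [CompleteSpace K]
  [NormedAddCommGroup L] [InnerProductSpace ℂ L] [CompleteSpace L]

/-- `T = ∑ᵢ |aᵢ⟩⟨bᵢ|` weakly, for square summable families `a` and `b`. -/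
structure IsRankOneSum (a b : ι → H) (T : H →L[ℂ] H) : Prop where
  summable_left : Summable fun i => ‖a i‖ ^ 2
  summable_right : Summable fun i => ‖b i‖ ^ 2
  hasSum_inner : ∀ x y, HasSum (fun i => ⟪x, a i⟫_ℂ * ⟪b i, y⟫_ℂ) ⟪x, T y⟫_ℂ

namespace IsRankOneSum

variable {a b : ι → H} {T : H →L[ℂ] H}

omit [CompleteSpace H] in
theorem summable_inner (h : IsRankOneSum a b T) : Summable fun i => ⟪b i, a i⟫_ℂ :=
  .of_norm <| .of_nonneg_of_le (fun _ => norm_nonneg _) (fun _ => norm_inner_le_norm _ _)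
    (summable_norm_mul_norm_of_sq h.summable_right h.summable_left)

omit [CompleteSpace H] in
-- The double series of `⟪eₙ, aᵢ⟫⟪bᵢ, eₙ⟫` converges absolutely, by Parseval and square summability.
-- Its row sums are the diagonal entries of `T`, its column sums are `⟪bᵢ, aᵢ⟫`; in particular the
-- trace does not depend on the basis.
theorem hasSum_diagonal (h : IsRankOneSum a b T) (e : HilbertBasis κ ℂ H) :
    HasSum (fun n => ⟪e n, T (e n)⟫_ℂ) (∑' i, ⟪b i, a i⟫_ℂ) := by
  have hF : Summable fun z : κ × ι => ⟪e z.1, a z.2⟫_ℂ * ⟪b z.2, e z.1⟫_ℂ := by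
    refine .of_norm ?_
    have := summable_norm_mul_norm_of_sq
      (summable_norm_sq_prod (fun i => e.hasSum_norm_inner_sq (a i)) h.summable_left)
      (summable_norm_sq_prod (fun i => e.hasSum_norm_inner_sq (b i)) h.summable_right)
    refine this.congr fun z => ?_
    rw [norm_mul, norm_inner_symm (b z.2)]
  have hrow := hF.hasSum.prod_fiberwise fun n => h.hasSum_inner (e n) (e n)
  have hcol := ((Equiv.prodComm ι κ).hasSum_iff.2 hF.hasSum).prod_fiberwise fun i =>
    (e.hasSum_inner_mul_inner (b i) (a i)).congr_fun fun n => mul_comm _ _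
  rwa [hcol.tsum_eq]

theorem opTrace_eq (h : IsRankOneSum a b T) : opTrace T = ∑' i, ⟪b i, a i⟫_ℂ :=
  (h.hasSum_diagonal (onb H)).tsum_eq

theorem mul_right (h : IsRankOneSum a b T) (X : H →L[ℂ] H) :
    IsRankOneSum a (fun i => adjoint X (b i)) (T * X) where
  summable_left := h.summable_left
  summable_right := by
    refine .of_nonneg_of_le (fun _ => by positivity) (fun i => ?_)
      (h.summable_right.mul_left (‖adjoint X‖ ^ 2))
    rw [← mul_pow]
    gcongr
    exact (adjoint X).le_opNorm _
  hasSum_inner x y := by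
    simpa only [adjoint_inner_left] using! h.hasSum_inner x (X y)

omit [CompleteSpace H] in
theorem isPositive (h : IsRankOneSum a a T) : T.IsPositive := by
  rw [isPositive_iff_complex]
  intro x
  have hx : HasSum (fun i => ((‖⟪a i, x⟫_ℂ‖ ^ 2 : ℝ) : ℂ)) ⟪x, T x⟫_ℂ := by
    refine (h.hasSum_inner x x).congr_fun fun i => ?_
    rw [← inner_conj_symm x (a i), ← Complex.normSq_eq_conj_mul_self, Complex.normSq_eq_norm_sq]
  have hs : Summable fun i => ‖⟪a i, x⟫_ℂ‖ ^ 2 := Complex.summable_ofReal.1 hx.summable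
  have heq := hx.unique (Complex.hasSum_ofReal.2 hs.hasSum)
  rw [← inner_conj_symm, heq]
  simpa using tsum_nonneg fun i => by positivity

omit [CompleteSpace H] in
theorem hasSum_re_diagonal (h : IsRankOneSum a a T) (e : HilbertBasis κ ℂ H) :
    HasSum (fun n => (⟪e n, T (e n)⟫_ℂ).re) (∑' i, ‖a i‖ ^ 2) := by
  have := Complex.hasSum_re (h.hasSum_diagonal e)
  simp only [inner_self_eq_norm_sq_to_K] at this
  have h2 : (∑' i, (‖a i‖ : ℂ) ^ 2) = ((∑' i, ‖a i‖ ^ 2 : ℝ) : ℂ) := by push_cast; rfl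
  simpa [h2] using! this

theorem isTraceClass (h : IsRankOneSum a a T) : IsTraceClass T := by
  unfold IsTraceClass
  rw [CFC.abs_of_nonneg T ((nonneg_iff_isPositive T).2 h.isPositive)]
  exact (h.hasSum_re_diagonal (onb H)).summable

omit [CompleteSpace H] in
theorem norm_inner_le (h : IsRankOneSum a b T) (x y : H) :
    ‖⟪x, T y⟫_ℂ‖ ≤ (∑' i, ‖a i‖ * ‖b i‖) * ‖x‖ * ‖y‖ := by
  have hs := (summable_norm_mul_norm_of_sq h.summable_left h.summable_right).hasSum
  have hle : ∀ i, ‖⟪x, a i⟫_ℂ * ⟪b i, y⟫_ℂ‖ ≤ (‖a i‖ * ‖b i‖) * (‖x‖ * ‖y‖) := fun i => by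
    rw [norm_mul]
    calc _ ≤ (‖x‖ * ‖a i‖) * (‖b i‖ * ‖y‖) := by gcongr <;> exact norm_inner_le_norm _ _
      _ = _ := by ring
  rw [← (h.hasSum_inner x y).tsum_eq, mul_assoc]
  exact tsum_of_norm_bounded (hs.mul_right _) hle

omit [CompleteSpace H] in
-- This bound makes the series defining a partial trace converge in operator norm.
theorem opNorm_le (h : IsRankOneSum a b T) : ‖T‖ ≤ ∑' i, ‖a i‖ * ‖b i‖ := by
  refine opNorm_le_of_re_inner_le (𝕜 := ℂ) (tsum_nonneg fun i => by positivity) fun x y hx hy => ?_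
  calc _ ≤ ‖⟪T x, y⟫_ℂ‖ := RCLike.re_le_norm _
    _ = ‖⟪y, T x⟫_ℂ‖ := norm_inner_symm _ _
    _ ≤ _ := by simpa [hx, hy] using h.norm_inner_le y x

theorem conj {a b : ι → L} {T : L →L[ℂ] L} (h : IsRankOneSum a b T) (J : K →L[ℂ] L) :
    IsRankOneSum (fun i => adjoint J (a i)) (fun i => adjoint J (b i)) (adjoint J ∘L T ∘L J) where
  summable_left := by
    refine .of_nonneg_of_le (fun _ => by positivity) (fun i => ?_)
      (h.summable_left.mul_left (‖adjoint J‖ ^ 2))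
    rw [← mul_pow]
    gcongr
    exact (adjoint J).le_opNorm _
  summable_right := by
    refine .of_nonneg_of_le (fun _ => by positivity) (fun i => ?_)
      (h.summable_right.mul_left (‖adjoint J‖ ^ 2))
    rw [← mul_pow]
    gcongr
    exact (adjoint J).le_opNorm _
  hasSum_inner x y := by
    simpa only [adjoint_inner_left, adjoint_inner_right, comp_apply] using
      h.hasSum_inner (J x) (J y)

omit [CompleteSpace H] in
theorem smul_of_nonneg (h : IsRankOneSum a a T) {c : ℝ} (hc : 0 ≤ c) :
    IsRankOneSum (fun i => (√c : ℂ) • a i) (fun i => (√c : ℂ) • a i) ((c : ℂ) • T) where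
  summable_left := by
    refine (h.summable_left.mul_left (‖(√c : ℂ)‖ ^ 2)).congr fun i => ?_
    rw [norm_smul, mul_pow]
  summable_right := by
    refine (h.summable_left.mul_left (‖(√c : ℂ)‖ ^ 2)).congr fun i => ?_
    rw [norm_smul, mul_pow]
  hasSum_inner x y := by
    have hcc : (c : ℂ) = √c * √c := by rw [← Complex.ofReal_mul, Real.mul_self_sqrt hc]
    rw [smul_apply, inner_smul_right]
    refine ((h.hasSum_inner x y).mul_left (c : ℂ)).congr_fun fun i => ?_
    rw [inner_smul_right, inner_smul_left, Complex.conj_ofReal, hcc]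
    ring

end IsRankOneSum

/-- Parseval inserted between the two factors of `T = √T √T`; no eigenvectors are needed. -/
theorem IsPositive.isRankOneSum {T : H →L[ℂ] H} (hT : T.IsPositive) (e : HilbertBasis κ ℂ H)
    (hs : Summable fun n => (⟪e n, T (e n)⟫_ℂ).re) :
    IsRankOneSum (fun n => CFC.sqrt T (e n)) (fun n => CFC.sqrt T (e n)) T := by
  have hT0 : 0 ≤ T := (nonneg_iff_isPositive T).2 hT
  have hS : (CFC.sqrt T).IsPositive := (nonneg_iff_isPositive _).1 (CFC.sqrt_nonneg T)
  have hSS (x y : H) : ⟪CFC.sqrt T x, CFC.sqrt T y⟫_ℂ = ⟪x, T y⟫_ℂ := by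
    rw [hS.inner_left_eq_inner_right]
    exact congr(⟪x, $(CFC.sqrt_mul_sqrt_self T hT0) y⟫_ℂ)
  have hsq : Summable fun n => ‖CFC.sqrt T (e n)‖ ^ 2 := by
    refine hs.congr fun n => ?_
    rw [← hSS]
    exact inner_self_eq_norm_sq (𝕜 := ℂ) _
  refine ⟨hsq, hsq, fun x y => ?_⟩
  rw [← hSS]
  exact (e.hasSum_inner_mul_inner (CFC.sqrt T x) (CFC.sqrt T y)).congr_fun fun n => by
    rw [hS.inner_left_eq_inner_right, hS.inner_left_eq_inner_right]

/-- Simultaneous rank one expansions of a self-adjoint trace class operator and of its absolute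
value. -/
theorem exists_isRankOneSum_of_isTraceClass {T : H →L[ℂ] H} (hT : IsSelfAdjoint T)
    (ht : IsTraceClass T) :
    ∃ (s : BasisIndex H ⊕ BasisIndex H → ℂ) (a : BasisIndex H ⊕ BasisIndex H → H),
      (∀ i, ‖s i‖ = 1) ∧ IsRankOneSum (fun i => s i • a i) a T ∧ IsRankOneSum a a (CFC.abs T) := by
  have hP : (T⁺).IsPositive := (nonneg_iff_isPositive _).1 (CFC.posPart_nonneg T)
  have hN : (T⁻).IsPositive := (nonneg_iff_isPositive _).1 (CFC.negPart_nonneg T)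
  have habs := CFC.posPart_add_negPart T hT
  have hsub := CFC.posPart_sub_negPart T hT
  have hre (n : BasisIndex H) : (⟪onb H n, CFC.abs T (onb H n)⟫_ℂ).re =
      (⟪onb H n, T⁺ (onb H n)⟫_ℂ).re + (⟪onb H n, T⁻ (onb H n)⟫_ℂ).re := by
    rw [← habs, add_apply, inner_add_right, Complex.add_re]
  have hP0 (n : BasisIndex H) : 0 ≤ (⟪onb H n, T⁺ (onb H n)⟫_ℂ).re :=
    hP.re_inner_nonneg_right _
  have hN0 (n : BasisIndex H) : 0 ≤ (⟪onb H n, T⁻ (onb H n)⟫_ℂ).re :=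
    hN.re_inner_nonneg_right _
  -- The diagonal entries of `T⁺` and `T⁻` are nonnegative and add up to those of `|T|`, so both
  -- parts inherit the trace class property.
  have rP := hP.isRankOneSum (onb H) (.of_nonneg_of_le hP0 (fun n => by linarith [hre n, hN0 n]) ht)
  have rN := hN.isRankOneSum (onb H) (.of_nonneg_of_le hN0 (fun n => by linarith [hre n, hP0 n]) ht)
  refine ⟨Sum.elim 1 (-1), Sum.elim (fun n => CFC.sqrt T⁺ (onb H n))
    fun n => CFC.sqrt T⁻ (onb H n), by rintro (i | i) <;> simp, ⟨?_, ?_, fun x y => ?_⟩,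
    ⟨?_, ?_, fun x y => ?_⟩⟩
  · exact .sum _ (by simpa [Function.comp_def] using rP.summable_left)
      (by simpa [Function.comp_def] using rN.summable_left)
  · exact .sum _ rP.summable_left rN.summable_left
  · rw [show ⟪x, T y⟫_ℂ = ⟪x, T⁺ y⟫_ℂ + -⟪x, T⁻ y⟫_ℂ by
      conv_lhs => rw [← hsub, sub_apply, inner_sub_right, sub_eq_add_neg]]
    exact .sum (by simpa [Function.comp_def] using rP.hasSum_inner x y)
      (by simpa [Function.comp_def] using (rN.hasSum_inner x y).neg)
  · exact .sum _ rP.summable_left rN.summable_left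
  · exact .sum _ rP.summable_left rN.summable_left
  · rw [← habs, add_apply, inner_add_right]
    exact .sum (rP.hasSum_inner x y) (rN.hasSum_inner x y)

/-- The operators `Jₙ` satisfy `∑ₙ Jₙ Jₙ* = 1` weakly. -/
def IsResolution (J : κ → K →L[ℂ] L) : Prop :=
  ∀ x y, HasSum (fun n => ⟪adjoint (J n) x, adjoint (J n) y⟫_ℂ) ⟪x, y⟫_ℂ

/-- Isometries `Jₙ` with mutually orthogonal ranges that span a dense subspace. -/
structure IsOrthogonalDecomposition (J : κ → K →L[ℂ] L) : Prop where
  inner_self : ∀ n x y, ⟪J n x, J n y⟫_ℂ = ⟪x, y⟫_ℂ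
  inner_of_ne : ∀ m n, m ≠ n → ∀ x y, ⟪J m x, J n y⟫_ℂ = 0
  eq_top_of_forall_mem :
    ∀ M : Submodule ℂ L, IsClosed (M : Set L) → (∀ n x, J n x ∈ M) → M = ⊤

/-- `L` is the Hilbert sum of the ranges, and the coordinates of `x` there are `Jₙ* x`; the claim is
the formula for the inner product of an `ℓ²` sum. -/
theorem IsOrthogonalDecomposition.isResolution {J : κ → K →L[ℂ] L}
    (hJ : IsOrthogonalDecomposition J) : IsResolution J := by
  classical
  let V (n : κ) : K →ₗᵢ[ℂ] L := (J n).toLinearMap.isometryOfInner (hJ.inner_self n)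
  have hV : IsHilbertSum ℂ (fun _ : κ => K) V := by
    refine .mk (fun m n hmn x y => hJ.inner_of_ne m n hmn x y) (top_le_iff.2 ?_)
    refine hJ.eq_top_of_forall_mem _ (Submodule.isClosed_topologicalClosure _) fun n x => ?_
    exact Submodule.le_topologicalClosure _ (Submodule.mem_iSup_of_mem n ⟨x, rfl⟩)
  have hcoord (x : L) (n : κ) : hV.linearIsometryEquiv x n = adjoint (J n) x := by
    refine ext_inner_left ℂ fun k => ?_
    refine (lp.inner_single_left (𝕜 := ℂ) (G := fun _ : κ => K) n k
      (hV.linearIsometryEquiv x)).symm.trans ?_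
    rw [adjoint_inner_right, ← hV.linearIsometryEquiv.symm.inner_map_map, hV.linearIsometryEquiv_symm_apply_single,
      LinearIsometryEquiv.symm_apply_apply]
    rfl
  intro x y
  simpa only [hcoord, LinearIsometryEquiv.inner_map_map] using
    lp.hasSum_inner (𝕜 := ℂ) (hV.linearIsometryEquiv x) (hV.linearIsometryEquiv y)

theorem IsResolution.hasSum_norm_sq {J : κ → K →L[ℂ] L} (hJ : IsResolution J) (x : L) :
    HasSum (fun n => ‖adjoint (J n) x‖ ^ 2) (‖x‖ ^ 2) := by
  have h := Complex.hasSum_re (hJ x x)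
  rw [show (⟪x, x⟫_ℂ).re = ‖x‖ ^ 2 from inner_self_eq_norm_sq (𝕜 := ℂ) x] at h
  exact h.congr_fun fun n => (inner_self_eq_norm_sq (𝕜 := ℂ) _).symm

/-- The partial trace along a resolution of the identity. -/
theorem IsRankOneSum.tsum_conj {J : κ → K →L[ℂ] L} (hJ : IsResolution J) {a b : ι → L}
    {T : L →L[ℂ] L} (h : IsRankOneSum a b T) :
    IsRankOneSum (fun z : κ × ι => adjoint (J z.1) (a z.2)) (fun z => adjoint (J z.1) (b z.2))
      (∑' n, adjoint (J n) ∘L T ∘L J n) := by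
  have ha := summable_norm_sq_prod (fun i => hJ.hasSum_norm_sq (a i)) h.summable_left
  have hb := summable_norm_sq_prod (fun i => hJ.hasSum_norm_sq (b i)) h.summable_right
  have hab := summable_norm_mul_norm_of_sq ha hb
  have hs : Summable fun n => adjoint (J n) ∘L T ∘L J n :=
    .of_norm <| .of_nonneg_of_le (fun _ => norm_nonneg _) (fun n => (h.conj (J n)).opNorm_le)
      hab.prod
  refine ⟨ha, hb, fun x y => ?_⟩
  have hF : Summable fun z : κ × ι =>
      ⟪x, adjoint (J z.1) (a z.2)⟫_ℂ * ⟪adjoint (J z.1) (b z.2), y⟫_ℂ := by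
    refine .of_norm <| .of_nonneg_of_le (fun _ => norm_nonneg _) (fun z => ?_)
      (hab.mul_left (‖x‖ * ‖y‖))
    rw [norm_mul]
    calc _ ≤ (‖x‖ * ‖adjoint (J z.1) (a z.2)‖) * (‖adjoint (J z.1) (b z.2)‖ * ‖y‖) := by
          gcongr <;> exact norm_inner_le_norm _ _
      _ = _ := by ring
  have hrow := hF.hasSum.prod_fiberwise fun n => (h.conj (J n)).hasSum_inner x y
  -- Matrix elements are continuous in the operator norm, so they pass through the series of
  -- operators.
  have hsum := (hs.hasSum.mapL (apply ℂ K y)).mapL (innerSL ℂ x)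
  simp only [apply_apply, innerSL_apply_apply] at hsum
  rw [← hrow.unique hsum]
  exact hF.hasSum

/-- The duality between partial trace and amplification. Intertwining gives `X* Jₙ* = Jₙ* Y*`;
summing the absolutely convergent double series over `n` first then removes the `Jₙ`. -/
theorem IsRankOneSum.opTrace_tsum_conj_mul {J : κ → K →L[ℂ] L} (hJ : IsResolution J) {a b : ι → L}
    {T : L →L[ℂ] L} (h : IsRankOneSum a b T) {X : K →L[ℂ] K} {Y : L →L[ℂ] L}
    (hXY : ∀ n, Y ∘L J n = J n ∘L X) :
    opTrace ((∑' n, adjoint (J n) ∘L T ∘L J n) * X) = ∑' i, ⟪b i, Y (a i)⟫_ℂ := by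
  have hR := (h.tsum_conj hJ).mul_right X
  have hadj (n : κ) (v : L) : adjoint X (adjoint (J n) v) = adjoint (J n) (adjoint Y v) := by
    simpa using congr($(congr(adjoint $(hXY n))) v).symm
  rw [hR.opTrace_eq]
  have hcol := ((Equiv.prodComm ι κ).hasSum_iff.2 hR.summable_inner.hasSum).prod_fiberwise
    (g := fun i => ⟪b i, Y (a i)⟫_ℂ) fun i => by
      simpa [hadj, adjoint_inner_left] using hJ (adjoint Y (b i)) (a i)
  exact hcol.tsum_eq.symm

end RankOneSum

end ContinuousLinearMap

/-! ### Tensor products of operators, and the isometries behind the partial traces. -/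

namespace HilbertTensor

open ContinuousLinearMap

section Operators

variable {E E' E'' F F' F'' G κ : Type*}
  [NormedAddCommGroup E] [InnerProductSpace ℂ E]
  [NormedAddCommGroup F] [InnerProductSpace ℂ F]
  [NormedAddCommGroup E'] [InnerProductSpace ℂ E']
  [NormedAddCommGroup F'] [InnerProductSpace ℂ F']
  [NormedAddCommGroup E''] [InnerProductSpace ℂ E'']
  [NormedAddCommGroup F''] [InnerProductSpace ℂ F'']
  [NormedAddCommGroup G] [InnerProductSpace ℂ G]

theorem submodule_eq_top {M : Submodule ℂ (HilbertTensor E F)}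
    (hM : IsClosed (M : Set (HilbertTensor E F))) (h : ∀ x y, tmul x y ∈ M) : M = ⊤ := by
  refine top_le_iff.1 fun v _ => denseRange_ofAlg.induction_on (p := fun v => v ∈ M) v hM fun t => ?_
  induction t using TensorProduct.induction_on with
  | zero => simp
  | tmul x y => exact h x y
  | add s t hs ht => rw [map_add]; exact M.add_mem hs ht

theorem ext_tmul {S T : HilbertTensor E F →L[ℂ] G} (h : ∀ x y, S (tmul x y) = T (tmul x y)) :
    S = T := by
  have := submodule_eq_top (M := LinearMap.ker (S - T).toLinearMap) (S - T).isClosed_ker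
    fun x y => by simp [h]
  ext v
  have hv : v ∈ LinearMap.ker (S - T).toLinearMap := by rw [this]; trivial
  simpa [sub_eq_zero] using hv

theorem map_comp_map (A : E →L[ℂ] E') (A' : E' →L[ℂ] E'') (B : F →L[ℂ] F') (B' : F' →L[ℂ] F'') :
    map A' B' ∘L map A B = map (A' ∘L A) (B' ∘L B) :=
  ext_tmul fun x y => by simp [map_tmul]

theorem map_mul_map (A A' : E →L[ℂ] E) (B B' : F →L[ℂ] F) :
    map A' B' * map A B = map (A' * A) (B' * B) :=
  map_comp_map A A' B B'

theorem map_one_one : map (1 : E →L[ℂ] E) (1 : F →L[ℂ] F) = 1 :=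
  ext_tmul fun x y => by simp [map_tmul]

theorem map_add_left (A A' : E →L[ℂ] E') (B : F →L[ℂ] F') :
    map (A + A') B = map A B + map A' B :=
  ext_tmul fun x y => by
    simp only [add_apply, map_tmul]; simp [tmul, TensorProduct.add_tmul]

theorem map_add_right (A : E →L[ℂ] E') (B B' : F →L[ℂ] F') :
    map A (B + B') = map A B + map A B' :=
  ext_tmul fun x y => by
    simp only [add_apply, map_tmul]; simp [tmul, TensorProduct.tmul_add]

theorem map_sub_left (A A' : E →L[ℂ] E') (B : F →L[ℂ] F') :
    map (A - A') B = map A B - map A' B :=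
  ext_tmul fun x y => by
    simp only [sub_apply, map_tmul]; simp [tmul, TensorProduct.sub_tmul]

theorem map_sub_right (A : E →L[ℂ] E') (B B' : F →L[ℂ] F') :
    map A (B - B') = map A B - map A B' :=
  ext_tmul fun x y => by
    simp only [sub_apply, map_tmul]; simp [tmul, TensorProduct.tmul_sub]

variable [CompleteSpace E] [CompleteSpace F] [CompleteSpace E'] [CompleteSpace F']

theorem adjoint_map (A : E →L[ℂ] E') (B : F →L[ℂ] F') :
    adjoint (map A B) = map (adjoint A) (adjoint B) := by
  refine ext_tmul fun x' y' => ext_inner_right ℂ fun v => ?_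
  rw [adjoint_inner_left, map_tmul]
  have : innerSL ℂ (tmul x' y') ∘L map A B = innerSL ℂ (tmul (adjoint A x') (adjoint B y')) :=
    ext_tmul fun x y => by simp [map_tmul, inner_tmul, adjoint_inner_left]
  simpa using congr($this v)

theorem isSelfAdjoint_map {A : E →L[ℂ] E} {B : F →L[ℂ] F} (hA : IsSelfAdjoint A)
    (hB : IsSelfAdjoint B) : IsSelfAdjoint (map A B) := by
  rw [isSelfAdjoint_iff, star_eq_adjoint, adjoint_map, ← star_eq_adjoint, ← star_eq_adjoint,
    hA.star_eq, hB.star_eq]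

/-- `A ⊗ B` is the square of the self-adjoint operator `√A ⊗ √B`. -/
theorem map_nonneg {A : E →L[ℂ] E} {B : F →L[ℂ] F} (hA : 0 ≤ A) (hB : 0 ≤ B) :
    0 ≤ map A B := by
  rw [← CFC.sqrt_mul_sqrt_self A hA, ← CFC.sqrt_mul_sqrt_self B hB, ← map_mul_map]
  have h := isSelfAdjoint_map (IsSelfAdjoint.of_nonneg (CFC.sqrt_nonneg A))
    (IsSelfAdjoint.of_nonneg (CFC.sqrt_nonneg B))
  simpa only [h.star_eq] using
    star_mul_self_nonneg (map (CFC.sqrt A) (CFC.sqrt B))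

end Operators

section Resolutions

variable {E F G κ : Type*}
  [NormedAddCommGroup E] [InnerProductSpace ℂ E] [CompleteSpace E]
  [NormedAddCommGroup F] [InnerProductSpace ℂ F] [CompleteSpace F]
  [NormedAddCommGroup G] [InnerProductSpace ℂ G] [CompleteSpace G]

omit [CompleteSpace E] [CompleteSpace F] in
theorem mem_of_forall_basis {M : Submodule ℂ F} (hM : IsClosed (M : Set F)) (S : E →L[ℂ] F)
    (e : HilbertBasis κ ℂ E) (h : ∀ n, S (e n) ∈ M) (x : E) : S x ∈ M := by
  have hx := hM.preimage S.continuous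
  have : (⊤ : Submodule ℂ E) ≤ M.comap S.toLinearMap := by
    rw [← e.dense_span]
    refine Submodule.topologicalClosure_minimal _ ?_ hx
    rw [Submodule.span_le]
    rintro _ ⟨n, rfl⟩
    exact h n
  exact this trivial

omit [CompleteSpace E] [CompleteSpace F] in
theorem isOrthogonalDecomposition_mkLeft (e : HilbertBasis κ ℂ E) :
    IsOrthogonalDecomposition fun n => mkLeft F (e n) where
  inner_self n x y := by simp [mkLeft_apply, inner_tmul, e.orthonormal.1 n]
  inner_of_ne m n hmn x y := by simp [mkLeft_apply, inner_tmul, e.orthonormal.inner_eq_zero hmn]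
  eq_top_of_forall_mem _ hM h := submodule_eq_top hM fun x y =>
    mem_of_forall_basis hM (mkRight E y) e (fun n => h n y) x

omit [CompleteSpace E] [CompleteSpace F] in
theorem isOrthogonalDecomposition_mkRight (e : HilbertBasis κ ℂ F) :
    IsOrthogonalDecomposition fun n => mkRight E (e n) where
  inner_self n x y := by simp [mkRight_apply, inner_tmul, e.orthonormal.1 n]
  inner_of_ne m n hmn x y := by simp [mkRight_apply, inner_tmul, e.orthonormal.inner_eq_zero hmn]
  eq_top_of_forall_mem _ hM h := submodule_eq_top hM fun x y =>
    mem_of_forall_basis hM (mkLeft F x) e (fun n => h n x) y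

/-- Orthogonality amounts to `Jₘ* Jₙ = δₘₙ`, which survives tensoring with the identity. Density is
checked on elementary tensors by pulling `M` back along `z ↦ x ⊗ z`. -/
theorem _root_.ContinuousLinearMap.IsOrthogonalDecomposition.map_id {J : κ → F →L[ℂ] G}
    (hJ : IsOrthogonalDecomposition J) :
    IsOrthogonalDecomposition fun n => map (.id ℂ E) (J n) where
  inner_self n x y := by
    have h : adjoint (J n) ∘L J n = 1 := by
      refine ContinuousLinearMap.ext fun v => ext_inner_left ℂ fun w => ?_
      simp [adjoint_inner_right, hJ.inner_self]
    have h' : map (.id ℂ E) (adjoint (J n)) ∘L map (.id ℂ E) (J n) = 1 := by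
      rw [map_comp_map, h]
      exact map_one_one
    rw [← adjoint_inner_right, adjoint_map, adjoint_id]
    exact congr(⟪x, $h' y⟫_ℂ)
  inner_of_ne m n hmn x y := by
    have h : adjoint (J m) ∘L J n = 0 := by
      refine ContinuousLinearMap.ext fun v => ext_inner_left ℂ fun w => ?_
      simp [adjoint_inner_right, hJ.inner_of_ne m n hmn]
    have h' : map (.id ℂ E) (adjoint (J m)) ∘L map (.id ℂ E) (J n) = 0 := by
      rw [map_comp_map, h]
      exact ext_tmul fun x y => by simp only [map_tmul]; simp [tmul]
    rw [← adjoint_inner_right, adjoint_map, adjoint_id, ← comp_apply, h']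
    simp
  eq_top_of_forall_mem M hM h := by
    refine submodule_eq_top hM fun x z => ?_
    have := hJ.eq_top_of_forall_mem (M.comap (mkLeft G x).toLinearMap)
      (hM.preimage (mkLeft G x).continuous) fun n y => by
        simpa [mkLeft_apply, map_tmul] using h n (tmul x y)
    exact this.ge (Submodule.mem_top (x := z))

end Resolutions

end HilbertTensor

/-! ### Bell's inequality for commuting elements of a C*-algebra. -/

section OperatorInequality

variable {R : Type*} [CStarAlgebra R] [PartialOrder R] [StarOrderedRing R]

theorem one_sub_mul_add_mul_sub_nonneg {a b c : R} (ha : a ∈ Set.Icc (-1) 1)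
    (hb : b ∈ Set.Icc (-1) 1) (hc : c ∈ Set.Icc (-1) 1) (hab : Commute a b) (hac : Commute a c)
    (hbc : Commute b c) : 0 ≤ (1 - b * c) + (a * b - a * c) := by
  have key {x y z : R} (hx : -1 ≤ x) (hy : -1 ≤ y) (hz : z ≤ 1) (hxy : Commute x y)
      (hxz : Commute x z) (hyz : Commute y z) : 0 ≤ (1 + x) * (1 + y) * (1 - z) := by
    have h₁ {u v : R} (h : Commute u v) : Commute (1 + u) (1 + v) :=
      (Commute.one_left _).add_left ((Commute.one_right u).add_right h)
    have h₂ {u v : R} (h : Commute u v) : Commute (1 + u) (1 - v) :=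
      (Commute.one_left _).add_left ((Commute.one_right u).sub_right h)
    have hx' : 0 ≤ 1 + x := by simpa [add_comm] using sub_nonneg.2 hx
    have hy' : 0 ≤ 1 + y := by simpa [add_comm] using sub_nonneg.2 hy
    exact Commute.mul_nonneg (Commute.mul_nonneg hx' hy' (h₁ hxy)) (sub_nonneg.2 hz)
      ((h₂ hxz).mul_left (h₂ hyz))
  have h₁ := key ha.1 hb.1 hc.2 hab hac hbc
  -- Changing all three signs fixes the quadratic terms and flips the linear and cubic ones, which
  -- therefore cancel in the sum.
  have h₂ := key (neg_le_neg ha.2) (neg_le_neg hb.2) (neg_le.1 hc.1) hab.neg_left.neg_right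
    hac.neg_left.neg_right hbc.neg_left.neg_right
  have h : (1 - b * c) + (a * b - a * c) = (2⁻¹ : ℝ) •
      ((1 + a) * (1 + b) * (1 - c) + (1 + -a) * (1 + -b) * (1 - -c)) := by
    rw [eq_inv_smul_iff₀ two_ne_zero, two_smul]
    noncomm_ring
  rw [h]
  exact smul_nonneg (by norm_num) (add_nonneg h₁ h₂)

end OperatorInequality

/-! ### Order bounds for observables and their amplifications. -/

namespace HilbertTensor

variable {E F : Type*}
  [NormedAddCommGroup E] [InnerProductSpace ℂ E] [CompleteSpace E]
  [NormedAddCommGroup F] [InnerProductSpace ℂ F] [CompleteSpace F]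

theorem map_one_mem_Icc {A : E →L[ℂ] E} (hA : A ∈ Set.Icc (-1) 1) :
    map A (1 : F →L[ℂ] F) ∈ Set.Icc (-1) 1 := by
  constructor
  · have := map_nonneg (sub_nonneg.2 hA.1) (zero_le_one (α := F →L[ℂ] F))
    rw [sub_neg_eq_add, map_add_left, map_one_one] at this
    rwa [← sub_nonneg, sub_neg_eq_add]
  · have := map_nonneg (sub_nonneg.2 hA.2) (zero_le_one (α := F →L[ℂ] F))
    rwa [map_sub_left, map_one_one, sub_nonneg] at this

theorem one_map_mem_Icc {B : F →L[ℂ] F} (hB : B ∈ Set.Icc (-1) 1) :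
    map (1 : E →L[ℂ] E) B ∈ Set.Icc (-1) 1 := by
  constructor
  · have := map_nonneg (zero_le_one (α := E →L[ℂ] E)) (sub_nonneg.2 hB.1)
    rw [sub_neg_eq_add, map_add_right, map_one_one] at this
    rwa [← sub_nonneg, sub_neg_eq_add]
  · have := map_nonneg (zero_le_one (α := E →L[ℂ] E)) (sub_nonneg.2 hB.2)
    rwa [map_sub_right, map_one_one, sub_nonneg] at this

end HilbertTensor

theorem IsContractiveObservable.mem_Icc {H : Type*} [NormedAddCommGroup H] [InnerProductSpace ℂ H]
    [CompleteSpace H] {W : H →L[ℂ] H} (hW : IsContractiveObservable W) : W ∈ Set.Icc (-1) 1 := by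
  have h {V : H →L[ℂ] H} (hV : IsSelfAdjoint V) (hn : ‖V‖ ≤ 1) : V ≤ 1 := by
    refine hV.le_algebraMap_norm_self.trans ?_
    simpa using algebraMap_mono (H →L[ℂ] H) hn
  exact ⟨neg_le.1 (h hW.selfAdjoint.neg (by simpa using hW.norm_le_one)),
    h hW.selfAdjoint hW.norm_le_one⟩

/-! ### The inequality for abstract partial traces. -/

namespace ContinuousLinearMap

variable {ι κ κ₁ κ₂ H K L M : Type*}
  [NormedAddCommGroup H] [InnerProductSpace ℂ H] [CompleteSpace H]
  [NormedAddCommGroup K] [InnerProductSpace ℂ K] [CompleteSpace K]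
  [NormedAddCommGroup L] [InnerProductSpace ℂ L] [CompleteSpace L]
  [NormedAddCommGroup M] [InnerProductSpace ℂ M] [CompleteSpace M]

omit [CompleteSpace H] in
theorem norm_inner_le_of_nonneg {P D : H →L[ℂ] H} (h₁ : 0 ≤ P + D) (h₂ : 0 ≤ P - D) (x : H) :
    ‖⟪x, D x⟫_ℂ‖ ≤ (⟪x, P x⟫_ℂ).re := by
  have h₁' := ((nonneg_iff_isPositive _).1 h₁).inner_nonneg_right x
  have h₂' := ((nonneg_iff_isPositive _).1 h₂).inner_nonneg_right x
  rw [add_apply, inner_add_right, Complex.le_def] at h₁'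
  rw [sub_apply, inner_sub_right, Complex.le_def] at h₂'
  simp only [Complex.add_re, Complex.add_im, Complex.sub_re, Complex.sub_im, Complex.zero_re,
    Complex.zero_im] at h₁' h₂'
  -- Positivity of both `P + D` and `P - D` forces `⟪x, D x⟫` to be real.
  rw [← Complex.abs_re_eq_norm.2 (by linarith), abs_le]
  constructor <;> linarith

theorem IsRankOneSum.summable_inner_apply {a b : ι → H} {T : H →L[ℂ] H} (h : IsRankOneSum a b T)
    (X : H →L[ℂ] H) : Summable fun i => ⟪b i, X (a i)⟫_ℂ := by
  simpa only [adjoint_inner_left] using (h.mul_right X).summable_inner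

theorem IsRankOneSum.traceNorm_eq {a : ι → H} {T : H →L[ℂ] H}
    (h : IsRankOneSum a a (CFC.abs T)) : traceNorm T = ∑' i, ‖a i‖ ^ 2 :=
  (h.hasSum_re_diagonal (onb H)).tsum_eq

theorem opTrace_smul (c : ℂ) (T : H →L[ℂ] H) : opTrace (c • T) = c * opTrace T := by
  simp only [opTrace, smul_apply, inner_smul_right, tsum_mul_left]

/-- Applied to a source-operator this gives `1 = |tr ρ| ≤ ‖T‖₁`, so that normalizing by `‖T‖₁` is
legitimate. -/
theorem norm_opTrace_tsum_conj_le {J : κ → K →L[ℂ] L} (hJ : IsResolution J) {T : L →L[ℂ] L}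
    (hT : IsSelfAdjoint T) (ht : IsTraceClass T) :
    ‖opTrace (∑' n, adjoint (J n) ∘L T ∘L J n)‖ ≤ traceNorm T := by
  obtain ⟨s, a, hs, h, habs⟩ := exists_isRankOneSum_of_isTraceClass hT ht
  have := h.opTrace_tsum_conj_mul hJ (X := 1) (Y := 1) fun n => rfl
  rw [mul_one] at this
  rw [this, habs.traceNorm_eq]
  refine tsum_of_norm_bounded habs.summable_left.hasSum fun i => ?_
  rw [show (1 : L →L[ℂ] L) (s i • a i) = s i • a i from rfl, inner_smul_right, norm_mul, hs,
    one_mul, sq]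
  exact norm_inner_le_norm _ _

theorem isDensityOperator_tsum_conj_abs {J : κ → K →L[ℂ] L} (hJ : IsResolution J) {T : L →L[ℂ] L}
    (hT : IsSelfAdjoint T) (ht : IsTraceClass T) (h0 : traceNorm T ≠ 0) :
    IsDensityOperator
      (((traceNorm T : ℂ)⁻¹) • ∑' n, adjoint (J n) ∘L CFC.abs T ∘L J n) := by
  obtain ⟨s, a, hs, -, h⟩ := exists_isRankOneSum_of_isTraceClass hT ht
  have hnn : 0 ≤ traceNorm T := by rw [h.traceNorm_eq]; exact tsum_nonneg fun i => by positivity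
  have hr := (h.tsum_conj hJ).smul_of_nonneg (inv_nonneg.2 hnn)
  rw [Complex.ofReal_inv] at hr
  refine ⟨hr.isPositive, hr.isTraceClass, ?_⟩
  have htr := h.opTrace_tsum_conj_mul hJ (X := 1) (Y := 1) fun n => rfl
  have hsum : (∑' i, ⟪a i, (1 : L →L[ℂ] L) (a i)⟫_ℂ) = (traceNorm T : ℂ) := by
    rw [h.traceNorm_eq, Complex.ofReal_tsum]
    refine tsum_congr fun i => ?_
    simp
  rw [mul_one, hsum] at htr
  rw [opTrace_smul, htr, inv_mul_cancel₀ (Complex.ofReal_ne_zero.2 h0)]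

/-- The abstract form of the inequality: `J₁` and `J₂` produce the same state `ρ` from `T`, and
`J` produces `σ` from `|T|`. -/
theorem norm_opTrace_sub_opTrace_le {J₁ : κ₁ → K →L[ℂ] L} {J₂ : κ₂ → K →L[ℂ] L}
    {J : κ → M →L[ℂ] L} (hJ₁ : IsResolution J₁) (hJ₂ : IsResolution J₂) (hJ : IsResolution J)
    {T : L →L[ℂ] L} (hT : IsSelfAdjoint T) (ht : IsTraceClass T) (h0 : traceNorm T ≠ 0)
    {ρ : K →L[ℂ] K} (hρ₁ : ∑' n, adjoint (J₁ n) ∘L T ∘L J₁ n = ρ)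
    (hρ₂ : ∑' n, adjoint (J₂ n) ∘L T ∘L J₂ n = ρ) {X₁ X₂ : K →L[ℂ] K} {W : M →L[ℂ] M}
    {Y₁ Y₂ Z : L →L[ℂ] L} (hY₁ : ∀ n, Y₁ ∘L J₁ n = J₁ n ∘L X₁)
    (hY₂ : ∀ n, Y₂ ∘L J₂ n = J₂ n ∘L X₂) (hZ : ∀ n, Z ∘L J n = J n ∘L W)
    (hZsa : IsSelfAdjoint Z) (hpos : 0 ≤ (1 - Z) + (Y₁ - Y₂)) (hneg : 0 ≤ (1 - Z) - (Y₁ - Y₂)) :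
    (opTrace ((((traceNorm T : ℂ)⁻¹) • ∑' n, adjoint (J n) ∘L CFC.abs T ∘L J n) * W)).im = 0 ∧
    ‖opTrace (ρ * X₁) - opTrace (ρ * X₂)‖ ≤ traceNorm T * (1 -
      (opTrace ((((traceNorm T : ℂ)⁻¹) • ∑' n, adjoint (J n) ∘L CFC.abs T ∘L J n) * W)).re) := by
  obtain ⟨s, a, hs, h, habs⟩ := exists_isRankOneSum_of_isTraceClass hT ht
  have h₁ := h.opTrace_tsum_conj_mul hJ₁ hY₁
  have h₂ := h.opTrace_tsum_conj_mul hJ₂ hY₂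
  rw [hρ₁] at h₁
  rw [hρ₂] at h₂
  have hreal (x : L) : ⟪x, Z x⟫_ℂ = ((⟪x, Z x⟫_ℂ).re : ℂ) :=
    (Complex.conj_eq_iff_re.1 (by
      rw [inner_conj_symm, ← adjoint_inner_right, ← star_eq_adjoint, hZsa.star_eq])).symm
  have hZs := Complex.hasSum_re (habs.summable_inner_apply Z).hasSum
  have hσ : opTrace ((((traceNorm T : ℂ)⁻¹) • ∑' n, adjoint (J n) ∘L CFC.abs T ∘L J n) * W) =
      (((traceNorm T)⁻¹ * ∑' i, (⟪a i, Z (a i)⟫_ℂ).re : ℝ) : ℂ) := by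
    rw [smul_mul_assoc, opTrace_smul, habs.opTrace_tsum_conj_mul hJ hZ, Complex.ofReal_mul,
      Complex.ofReal_inv, Complex.ofReal_tsum]
    congr 1
    exact tsum_congr fun i => hreal (a i)
  rw [hσ]
  refine ⟨Complex.ofReal_im _, ?_⟩
  rw [Complex.ofReal_re, mul_sub, mul_one, mul_inv_cancel_left₀ h0, h₁, h₂,
    ← (h.summable_inner_apply Y₁).tsum_sub (h.summable_inner_apply Y₂), habs.traceNorm_eq]
  -- Termwise comparison: the phase `sᵢ` has modulus one, so `T` on the left is dominated by `|T|`
  -- on the right.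
  refine tsum_of_norm_bounded (habs.summable_left.hasSum.sub hZs.summable.hasSum) fun i => ?_
  have hi := norm_inner_le_of_nonneg hpos hneg (a i)
  rw [sub_apply, sub_apply, inner_sub_right, inner_sub_right, Complex.sub_re,
    show (⟪a i, (1 : L →L[ℂ] L) (a i)⟫_ℂ).re = ‖a i‖ ^ 2 from inner_self_eq_norm_sq (𝕜 := ℂ) _] at hi
  rwa [map_smul, map_smul, inner_smul_right, inner_smul_right, ← mul_sub, norm_mul, hs, one_mul]

theorem norm_opTrace_sub_opTrace_le_of_commute {J₁ : κ₁ → K →L[ℂ] L} {J₂ : κ₂ → K →L[ℂ] L}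
    {J : κ → M →L[ℂ] L} (hJ₁ : IsResolution J₁) (hJ₂ : IsResolution J₂) (hJ : IsResolution J)
    {T : L →L[ℂ] L} (hT : IsSelfAdjoint T) (ht : IsTraceClass T) (h0 : traceNorm T ≠ 0)
    {ρ : K →L[ℂ] K} (hρ₁ : ∑' n, adjoint (J₁ n) ∘L T ∘L J₁ n = ρ)
    (hρ₂ : ∑' n, adjoint (J₂ n) ∘L T ∘L J₂ n = ρ) {X₁ X₂ : K →L[ℂ] K} {W : M →L[ℂ] M}
    {a b c Y₁ Y₂ Z : L →L[ℂ] L} (ha : a ∈ Set.Icc (-1) 1) (hb : b ∈ Set.Icc (-1) 1)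
    (hc : c ∈ Set.Icc (-1) 1) (hab : a * b = Y₁) (hba : b * a = Y₁) (hac : a * c = Y₂)
    (hca : c * a = Y₂) (hbc : b * c = Z) (hcb : c * b = Z)
    (hY₁ : ∀ n, Y₁ ∘L J₁ n = J₁ n ∘L X₁) (hY₂ : ∀ n, Y₂ ∘L J₂ n = J₂ n ∘L X₂)
    (hZ : ∀ n, Z ∘L J n = J n ∘L W) (hZsa : IsSelfAdjoint Z) :
    (opTrace ((((traceNorm T : ℂ)⁻¹) • ∑' n, adjoint (J n) ∘L CFC.abs T ∘L J n) * W)).im = 0 ∧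
    ‖opTrace (ρ * X₁) - opTrace (ρ * X₂)‖ ≤ traceNorm T * (1 -
      (opTrace ((((traceNorm T : ℂ)⁻¹) • ∑' n, adjoint (J n) ∘L CFC.abs T ∘L J n) * W)).re) := by
  have cab : Commute a b := hab.trans hba.symm
  have cac : Commute a c := hac.trans hca.symm
  have cbc : Commute b c := hbc.trans hcb.symm
  have hpos := one_sub_mul_add_mul_sub_nonneg ha hb hc cab cac cbc
  -- Replacing `a` by `-a` reverses `ab - ac` and leaves `bc` alone, which yields the other sign.
  have hneg := one_sub_mul_add_mul_sub_nonneg (a := -a)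
    ⟨neg_le_neg ha.2, neg_le.1 ha.1⟩ hb hc cab.neg_left cac.neg_left cbc
  rw [neg_mul, neg_mul, ← neg_sub', ← sub_eq_add_neg] at hneg
  rw [hab, hac, hbc] at hpos hneg
  exact norm_opTrace_sub_opTrace_le hJ₁ hJ₂ hJ hT ht h0 hρ₁ hρ₂ hY₁ hY₂ hZ hZsa hpos hneg

end ContinuousLinearMap

/-! ### Intertwining relations for the tensor isometries. -/

namespace HilbertTensor

variable {E F G : Type*}
  [NormedAddCommGroup E] [InnerProductSpace ℂ E]
  [NormedAddCommGroup F] [InnerProductSpace ℂ F]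
  [NormedAddCommGroup G] [InnerProductSpace ℂ G]

theorem one_map_comp_mkLeft (B : F →L[ℂ] F) (x : E) :
    map 1 B ∘L mkLeft F x = mkLeft F x ∘L B :=
  ContinuousLinearMap.ext fun y => map_tmul 1 B x y

theorem map_one_comp_mkRight (A : E →L[ℂ] E) (y : F) :
    map A 1 ∘L mkRight E y = mkRight E y ∘L A :=
  ContinuousLinearMap.ext fun x => map_tmul A 1 x y

theorem map_comp_map_id {J : F →L[ℂ] G} {B : F →L[ℂ] F} {C : G →L[ℂ] G} (h : C ∘L J = J ∘L B)
    (A : E →L[ℂ] E) : map A C ∘L map (.id ℂ E) J = map (.id ℂ E) J ∘L map A B := by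
  rw [map_comp_map, map_comp_map, h]
  rfl

end HilbertTensor

/-! ### The two kinds of source-operators. -/

section SourceOperators

open HilbertTensor ContinuousLinearMap

theorem traceNorm_ne_zero_of_norm_le {K H : Type*} [NormedAddCommGroup H] [InnerProductSpace ℂ H]
    [CompleteSpace H] [NormedAddCommGroup K] [InnerProductSpace ℂ K] [CompleteSpace K]
    {ρ : K →L[ℂ] K} (hρ : IsDensityOperator ρ) {T : H →L[ℂ] H}
    (h : ‖opTrace ρ‖ ≤ traceNorm T) : traceNorm T ≠ 0 := by
  rw [hρ.trace_eq_one, norm_one] at h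
  exact (zero_lt_one.trans_le h).ne'

variable {H₁ : Type u} {H₂ : Type v}
  [NormedAddCommGroup H₁] [InnerProductSpace ℂ H₁] [CompleteSpace H₁]
  [NormedAddCommGroup H₂] [InnerProductSpace ℂ H₂] [CompleteSpace H₂]
  {ρ : HilbertTensor H₁ H₂ →L[ℂ] HilbertTensor H₁ H₂}

theorem IsSourceOperator₁₂₂.traceNorm_ne_zero
    {T : HilbertTensor H₁ (HilbertTensor H₂ H₂) →L[ℂ] HilbertTensor H₁ (HilbertTensor H₂ H₂)}
    (hT : IsSourceOperator₁₂₂ ρ T) (hρ : IsDensityOperator ρ) : traceNorm T ≠ 0 := by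
  refine traceNorm_ne_zero_of_norm_le hρ ?_
  rw [← hT.partialTrace₂_eq]
  exact norm_opTrace_tsum_conj_le
    (isOrthogonalDecomposition_mkLeft (onb H₂)).map_id.isResolution hT.selfAdjoint hT.traceClass

omit [CompleteSpace H₂] in
theorem IsSourceOperator₁₁₂.traceNorm_ne_zero
    {T : HilbertTensor H₁ (HilbertTensor H₁ H₂) →L[ℂ] HilbertTensor H₁ (HilbertTensor H₁ H₂)}
    (hT : IsSourceOperator₁₁₂ ρ T) (hρ : IsDensityOperator ρ) : traceNorm T ≠ 0 := by
  refine traceNorm_ne_zero_of_norm_le hρ ?_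
  rw [← hT.partialTrace₁_eq]
  exact norm_opTrace_tsum_conj_le
    (isOrthogonalDecomposition_mkLeft (onb H₁)).isResolution hT.selfAdjoint hT.traceClass

/-- Tracing out the second place leaves `B₁` acting on the third, and tracing out the third leaves
`B₂` on the second; hence the order `B₂ ⊗ B₁` in `σ`. -/
theorem IsSourceOperator₁₂₂.norm_opTrace_sub_le
    {T : HilbertTensor H₁ (HilbertTensor H₂ H₂) →L[ℂ] HilbertTensor H₁ (HilbertTensor H₂ H₂)}
    (hT : IsSourceOperator₁₂₂ ρ T) (hρ : IsDensityOperator ρ) {A : H₁ →L[ℂ] H₁}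
    {B₁ B₂ : H₂ →L[ℂ] H₂} (hA : IsContractiveObservable A) (hB₁ : IsContractiveObservable B₁)
    (hB₂ : IsContractiveObservable B₂) :
    (opTrace (sigma₁₂₂ T * HilbertTensor.map B₂ B₁)).im = 0 ∧
    ‖opTrace (ρ * HilbertTensor.map A B₁) - opTrace (ρ * HilbertTensor.map A B₂)‖
      ≤ traceNorm T * (1 - (opTrace (sigma₁₂₂ T * HilbertTensor.map B₂ B₁)).re) := by
  have hJ₁ := ((isOrthogonalDecomposition_mkLeft (F := H₂) (onb H₂)).map_id (E := H₁)).isResolution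
  have hJ₂ := ((isOrthogonalDecomposition_mkRight (E := H₂) (onb H₂)).map_id (E := H₁)).isResolution
  have hJ := (isOrthogonalDecomposition_mkLeft (F := HilbertTensor H₂ H₂) (onb H₁)).isResolution
  have h₁ := hT.partialTrace₂_eq
  have h₂ := hT.partialTrace₃_eq
  unfold partialTrace₂ at h₁
  unfold partialTrace₃ at h₂
  unfold sigma₁₂₂ partialTrace₁
  have hY₁ (n : BasisIndex H₂) := map_comp_map_id (one_map_comp_mkLeft B₁ (onb H₂ n)) A
  have hY₂ (n : BasisIndex H₂) := map_comp_map_id (map_one_comp_mkRight B₂ (onb H₂ n)) A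
  have hZ (n : BasisIndex H₁) := one_map_comp_mkLeft (map B₂ B₁) (onb H₁ n)
  have ha := map_one_mem_Icc (F := HilbertTensor H₂ H₂) hA.mem_Icc
  have hb := one_map_mem_Icc (E := H₁) (one_map_mem_Icc (E := H₂) hB₁.mem_Icc)
  have hc := one_map_mem_Icc (E := H₁) (map_one_mem_Icc (F := H₂) hB₂.mem_Icc)
  have hsa := isSelfAdjoint_map (.one (H₁ →L[ℂ] H₁))
    (isSelfAdjoint_map hB₂.selfAdjoint hB₁.selfAdjoint)
  refine norm_opTrace_sub_opTrace_le_of_commute hJ₁ hJ₂ hJ hT.selfAdjoint hT.traceClass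
    (hT.traceNorm_ne_zero hρ) h₁ h₂ ha hb hc ?_ ?_ ?_ ?_ ?_ ?_ hY₁ hY₂ hZ hsa
  all_goals simp only [map_mul_map, one_mul, mul_one]

/-- Here the common factor is `1 ⊗ 1 ⊗ B`; `A₁` sits on the second place and `A₂` on the first, so
`σ` is paired with `A₂ ⊗ A₁`. -/
theorem IsSourceOperator₁₁₂.norm_opTrace_sub_le
    {T : HilbertTensor H₁ (HilbertTensor H₁ H₂) →L[ℂ] HilbertTensor H₁ (HilbertTensor H₁ H₂)}
    (hT : IsSourceOperator₁₁₂ ρ T) (hρ : IsDensityOperator ρ) {A₁ A₂ : H₁ →L[ℂ] H₁}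
    {B : H₂ →L[ℂ] H₂} (hA₁ : IsContractiveObservable A₁) (hA₂ : IsContractiveObservable A₂)
    (hB : IsContractiveObservable B) :
    (opTrace (sigma₁₁₂ T * HilbertTensor.map A₂ A₁)).im = 0 ∧
    ‖opTrace (ρ * HilbertTensor.map A₁ B) - opTrace (ρ * HilbertTensor.map A₂ B)‖
      ≤ traceNorm T * (1 - (opTrace (sigma₁₁₂ T * HilbertTensor.map A₂ A₁)).re) := by
  have hJ₁ := (isOrthogonalDecomposition_mkLeft (F := HilbertTensor H₁ H₂) (onb H₁)).isResolution
  have hJ₂ := ((isOrthogonalDecomposition_mkLeft (F := H₂) (onb H₁)).map_id (E := H₁)).isResolution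
  have hJ := ((isOrthogonalDecomposition_mkRight (E := H₁) (onb H₂)).map_id (E := H₁)).isResolution
  have h₁ := hT.partialTrace₁_eq
  have h₂ := hT.partialTrace₂_eq
  unfold partialTrace₁ at h₁
  unfold partialTrace₂ at h₂
  unfold sigma₁₁₂ partialTrace₃
  have hY₁ (n : BasisIndex H₁) := one_map_comp_mkLeft (map A₁ B) (onb H₁ n)
  have hY₂ (n : BasisIndex H₁) := map_comp_map_id (one_map_comp_mkLeft B (onb H₁ n)) A₂
  have hZ (n : BasisIndex H₂) := map_comp_map_id (map_one_comp_mkRight A₁ (onb H₂ n)) A₂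
  have ha := one_map_mem_Icc (E := H₁) (one_map_mem_Icc (E := H₁) hB.mem_Icc)
  have hb := one_map_mem_Icc (E := H₁) (map_one_mem_Icc (F := H₂) hA₁.mem_Icc)
  have hc := map_one_mem_Icc (F := HilbertTensor H₁ H₂) hA₂.mem_Icc
  have hsa := isSelfAdjoint_map hA₂.selfAdjoint
    (isSelfAdjoint_map hA₁.selfAdjoint (.one (H₂ →L[ℂ] H₂)))
  refine norm_opTrace_sub_opTrace_le_of_commute hJ₁ hJ₂ hJ hT.selfAdjoint hT.traceClass
    (hT.traceNorm_ne_zero hρ) h₁ h₂ ha hb hc ?_ ?_ ?_ ?_ ?_ ?_ hY₁ hY₂ hZ hsa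
  all_goals simp only [map_mul_map, one_mul, mul_one]

end SourceOperators

theorem proposition3 {H₁ : Type u} {H₂ : Type v}
    [NormedAddCommGroup H₁] [InnerProductSpace ℂ H₁] [CompleteSpace H₁]
    [TopologicalSpace.SeparableSpace H₁]
    [NormedAddCommGroup H₂] [InnerProductSpace ℂ H₂] [CompleteSpace H₂]
    [TopologicalSpace.SeparableSpace H₂]
    (ρ : HilbertTensor H₁ H₂ →L[ℂ] HilbertTensor H₁ H₂) (hρ : IsDensityOperator ρ) :
    (∀ T : HilbertTensor H₁ (HilbertTensor H₂ H₂) →L[ℂ] HilbertTensor H₁ (HilbertTensor H₂ H₂),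
      IsSourceOperator₁₂₂ ρ T →
        IsDensityOperator (sigma₁₂₂ T) ∧
        ∀ (A : H₁ →L[ℂ] H₁) (B₁ B₂ : H₂ →L[ℂ] H₂), IsContractiveObservable A →
          IsContractiveObservable B₁ → IsContractiveObservable B₂ →
          (opTrace (sigma₁₂₂ T * HilbertTensor.map B₁ B₂)).im = 0 ∧
          (opTrace (sigma₁₂₂ T * HilbertTensor.map B₂ B₁)).im = 0 ∧
          ‖opTrace (ρ * HilbertTensor.map A B₁) - opTrace (ρ * HilbertTensor.map A B₂)‖
            ≤ traceNorm T * (1 - (opTrace (sigma₁₂₂ T * HilbertTensor.map B₁ B₂)).re) ∧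
          ‖opTrace (ρ * HilbertTensor.map A B₁) - opTrace (ρ * HilbertTensor.map A B₂)‖
            ≤ traceNorm T * (1 - (opTrace (sigma₁₂₂ T * HilbertTensor.map B₂ B₁)).re)) ∧
    (∀ T : HilbertTensor H₁ (HilbertTensor H₁ H₂) →L[ℂ] HilbertTensor H₁ (HilbertTensor H₁ H₂),
      IsSourceOperator₁₁₂ ρ T →
        IsDensityOperator (sigma₁₁₂ T) ∧
        ∀ (A₁ A₂ : H₁ →L[ℂ] H₁) (B : H₂ →L[ℂ] H₂), IsContractiveObservable A₁ →
          IsContractiveObservable A₂ → IsContractiveObservable B →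
          (opTrace (sigma₁₁₂ T * HilbertTensor.map A₁ A₂)).im = 0 ∧
          (opTrace (sigma₁₁₂ T * HilbertTensor.map A₂ A₁)).im = 0 ∧
          ‖opTrace (ρ * HilbertTensor.map A₁ B) - opTrace (ρ * HilbertTensor.map A₂ B)‖
            ≤ traceNorm T * (1 - (opTrace (sigma₁₁₂ T * HilbertTensor.map A₁ A₂)).re) ∧
          ‖opTrace (ρ * HilbertTensor.map A₁ B) - opTrace (ρ * HilbertTensor.map A₂ B)‖
            ≤ traceNorm T * (1 - (opTrace (sigma₁₁₂ T * HilbertTensor.map A₂ A₁)).re)) := by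
  refine ⟨fun T hT => ⟨?_, fun A B₁ B₂ hA hB₁ hB₂ => ?_⟩,
    fun T hT => ⟨?_, fun A₁ A₂ B hA₁ hA₂ hB => ?_⟩⟩
  · exact ContinuousLinearMap.isDensityOperator_tsum_conj_abs
      (HilbertTensor.isOrthogonalDecomposition_mkLeft (onb H₁)).isResolution
      hT.selfAdjoint hT.traceClass (hT.traceNorm_ne_zero hρ)
  · have h := hT.norm_opTrace_sub_le hρ hA hB₁ hB₂
    -- The left-hand side is symmetric in `B₁` and `B₂`, so exchanging them gives the other tensor
    -- order.
    have h' := hT.norm_opTrace_sub_le hρ hA hB₂ hB₁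
    rw [norm_sub_rev] at h'
    exact ⟨h'.1, h.1, h'.2, h.2⟩
  · exact ContinuousLinearMap.isDensityOperator_tsum_conj_abs
      (HilbertTensor.isOrthogonalDecomposition_mkRight (onb H₂)).map_id.isResolution
      hT.selfAdjoint hT.traceClass (hT.traceNorm_ne_zero hρ)
  · have h := hT.norm_opTrace_sub_le hρ hA₁ hA₂ hB
    have h' := hT.norm_opTrace_sub_le hρ hA₂ hA₁ hB
    rw [norm_sub_rev] at h'
    exact ⟨h'.1, h.1, h'.2, h.2⟩
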